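/- **Setting.** A *discard category* is a symmetric monoidal category $(\mathcal C,\otimes,I)$ with a map $\mathsf{d}_A:A\to I$ for every object $A$, such that $\mathsf{d}_I=\mathrm{id}_I$ and $\mathsf{d}_{A\otimes B}=\mathsf{d}_A\otimes \mathsf{d}_B$. A morphism $f:A\to B$ is *causal* if $\mathsf{d}_B\circ f=\mathsf{d}_A$. A *prop* is a strict symmetric monoidal category whose monoid of objects is $(\mathbb N,+,0)$. Let $\mathcal G$ be a discard prop, $\mathcal C$ a discard category, and $[\![-]\!]:\mathcal G\to\mathcal C$ a (strong) symmetric monoidal functor that preserves discard maps. Iterated tensor products in $\mathcal C$ are bracketed to the left. **The language $\mathcal G^\omega$.** Colors are generated by $1$, $\omega$ and $c\mapsto \mathrm D c$; types are finite lists of colors, with concatenation $+$ as tensor, and $\mathrm D$ acts on each color of a type. Diagrams $a\to b$ are generated, under composition and tensor, by identities, swaps, $\mathrm D^j g:\mathrm D^j n\to \mathrm D^j m$ and $\mathrm D^j\omega g:\mathrm D^j n\omega\to\mathrm D^j m\omega$ for $g:n\to m$ in $\mathcal G$, derivatives $\mathrm D^j\omega\to\mathrm D^j1+\mathrm D^{j+1}\omega$,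 initializations $\mathrm D^j1+\mathrm D^{j+1}\omega\to\mathrm D^j\omega$, and the delayed trace, which turns $D:a+\mathrm D c\to b+c$ into a diagram $a\to b$. The delay $a\to\mathrm D a$ is the delayed trace of the swap $a+\mathrm D a\to\mathrm D a+a$. Morphisms of $\mathcal G^\omega$ are diagrams modulo the congruence given by: the laws of colored props; functoriality and monoidality of $g\mapsto\mathrm D^jg$ and $g\mapsto\mathrm D^j\omega g$; derivative and initialization are mutually inverse, and initialization commutes with the generators ($\omega g$ after initialization equals initialization after $g+\mathrm D\omega g$); naturality, superposition and vanishing of the delayed trace; the delay commutes with derivatives, initializations, swaps and causal morphisms of $\mathcal G$; an idempotent $\pi$ of $\mathcal G$ satisfies $\mathrm{delay}\circ\pi=\mathrm D\pi\circ\mathrm{delay}\circ\pi$; all delayed versions of these; and the coinduction rule: if for every $n$ the equation $S_n=T_n$ is derivable with the additional hypothesis $\mathrm D S_{n+1}=\mathrm D T_{n+1}$, then $S_0=T_0$. **Semantics.** Ticks are $k=1,2,\dots$. The color $1$ sends data at tick $1$ only, $\omega$ at every tick, and $\mathrm Dc$ at tick $k+1$ iff $c$ does at tick $k$, and not at tick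 $1$. For a type $a$ let $a_k\in\mathbb N$ be the number of its colors that send data at tick $k$. A *stateful morphism sequence* consists of memory objects $m_0=I,m_1,m_2,\dots$ and layers $f_k:a_k\otimes m_{k-1}\to b_k\otimes m_k$. A diagram $D:a\to b$ unfolds to a stateful morphism sequence $\partial D$ over $\mathcal G$: composition and tensor are layerwise with memories put side by side; a generator from $g$ acts as $g$ at each tick when its color sends data, and trivially otherwise; swaps are layerwise swaps; derivatives and initializations are layerwise identities; the delayed trace over $c$ adds $c_k$ to the memory after tick $k$ and feeds it back as the $\mathrm Dc$-input at tick $k+1$. Apply $[\![-]\!]$ to each layer. Then $[\![D]\!]^\omega_k:[\![a]\!]^\omega_k\to[\![b]\!]^\omega_k$, where $[\![a]\!]^\omega_k=[\![a_1]\!]\otimes\dots\otimes[\![a_k]\!]$, is obtained by plugging the first $k$ layers together along the memories and discarding the last memory. **Finite approximation sequences.** For $f,g:A\to B$ in $\mathcal C$ write $f\preceq g$ if there are an object $X$, $g_0:A\to B\otimes X$ and $f_0:X\to I$ with $f=(\mathrm{id}_B\otimes f_0)\circ g_0$ and $g=(\mathrm{id}_B\otimes \mathsf{d}_X)\circ g_0$.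 A sequence of objects $(A_k)_{k\ge1}$ belongs to $\mathrm{FA}(\mathcal C)$ if it is *monotone*: $A_{k+1}=A_k\otimes A'_k$ for some objects $A'_k$ $(k\ge 1)$, and *regular*: there are $n\ge1$ and $A'$ with $A_k=A_n\otimes A'^{\otimes(k-n)}$ for all $k\ge n$. A sequence of morphisms $g_k:A_k\to B_k$ between such sequences (with chosen $A'_k,B'_k$) belongs to $\mathrm{FA}(\mathcal C)$ if it is *monotone*: for all $k\ge1$, $$(\mathrm{id}_{B_k}\otimes \mathsf{d}_{B'_k})\circ g_{k+1}\;\preceq\; g_k\otimes \mathsf{d}_{A'_k},$$ and *regular*: there are $n\ge1$, objects $A',B'$ as in the regularity of $(A_k)$ and $(B_k)$ from rank $n$, an object $M$, and morphisms $g^{\mathrm{irreg}}:A_n\to B_n\otimes M$, $g^{\mathrm{reg}}:M\otimes A'\to B'\otimes M$ such that for all $k\ge n$, $g_k$ is the composite of $g^{\mathrm{irreg}}$ with $k-n$ copies of $g^{\mathrm{reg}}$ plugged successively along $M$, followed by discarding the last $M$. **Proposition.** For every type $a$ the sequence $[\![a]\!]^\omega$ is monotone and regular, and factors $A'_k$ can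 be chosen for each type such that, for every morphism $f:a\to b$ of $\mathcal G^\omega$ and every diagram $D$ that represents $f$, the sequence $[\![D]\!]^\omega:[\![a]\!]^\omega\to[\![b]\!]^\omega$ is monotone and regular, i.e. $[\![D]\!]^\omega\in\mathrm{FA}(\mathcal C)$. -/

import Mathlib

open CategoryTheory MonoidalCategory

namespace StreamLang

universe v u v' u'

/-! ### Discard categories and props -/

/-- A discard category: a symmetric monoidal category with a discard map on every object, compatible
with the unit and the tensor (the unitor only identifies `I ⊗ I` with `I`). -/
class DiscardCategory (C : Type u) [Category.{v} C] [MonoidalCategory C]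
    [SymmetricCategory C] where
  discard (A : C) : A ⟶ 𝟙_ C
  discard_unit : discard (𝟙_ C) = 𝟙 (𝟙_ C)
  discard_tensor (A B : C) :
    discard (A ⊗ B) = (discard A ⊗ₘ discard B) ≫ (λ_ (𝟙_ C)).hom

/-- The discard map `A ⟶ I`. -/
abbrev ground {C : Type u} [Category.{v} C] [MonoidalCategory C] [SymmetricCategory C]
    [DiscardCategory C] (A : C) : A ⟶ 𝟙_ C :=
  DiscardCategory.discard A

/-- A monochromatic prop: a strict symmetric monoidal category whose monoid of objects is freely
generated by one object. The object `n` of the prop is `wires n`. -/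
class PropCategory (G : Type u) [Category.{v} G] [MonoidalCategory G]
    [SymmetricCategory G] where
  wires : ℕ ≃ G
  wires_zero : wires 0 = 𝟙_ G
  wires_add (m n : ℕ) : wires (m + n) = wires m ⊗ wires n
  associator_strict (X Y Z : G) :
    ∃ h : (X ⊗ Y) ⊗ Z = X ⊗ (Y ⊗ Z), (α_ X Y Z).hom = eqToHom h
  leftUnitor_strict (X : G) : ∃ h : 𝟙_ G ⊗ X = X, (λ_ X).hom = eqToHom h
  rightUnitor_strict (X : G) : ∃ h : X ⊗ 𝟙_ G = X, (ρ_ X).hom = eqToHom h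

/-- The object `n` of a prop. -/
abbrev wires (G : Type u) [Category.{v} G] [MonoidalCategory G] [SymmetricCategory G]
    [PropCategory G] (n : ℕ) : G :=
  PropCategory.wires n

/-- Causal morphisms. -/
def IsCausal {C : Type u} [Category.{v} C] [MonoidalCategory C] [SymmetricCategory C]
    [DiscardCategory C] {A B : C} (f : A ⟶ B) : Prop :=
  f ≫ ground B = ground A

/-- A (strong) monoidal functor between discard categories is discard-preserving if it sends
discard maps to discard maps, up to the comparison `I ≅ F I`. -/
def DiscardPreserving {G : Type u} [Category.{v} G] [MonoidalCategory G] [SymmetricCategory G]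
    [DiscardCategory G] {C : Type u'} [Category.{v'} C] [MonoidalCategory C]
    [SymmetricCategory C] [DiscardCategory C] (F : G ⥤ C) [F.Monoidal] : Prop :=
  ∀ A : G, F.map (ground A) = ground (F.obj A) ≫ Functor.LaxMonoidal.ε F

/-! ### Colors and types of the stream language -/

/-- Colors: `1`, `ω`, and delayed colors. -/
inductive Color : Type
  | one : Color
  | omega : Color
  | delay : Color → Color

/-- `c` delayed `j` times. -/
def Color.delayed : ℕ → Color → Color
  | 0, c => c
  | j + 1, c => Color.delay (Color.delayed j c)

/-- Whether a wire of the given color sends a unit of data at the given tick. Ticks are numbered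
from `0` here: index `k` is the `(k + 1)`-st tick. -/
def Color.active : Color → ℕ → Bool
  | .one, 0 => true
  | .one, _ + 1 => false
  | .omega, _ => true
  | .delay _, 0 => false
  | .delay c, k + 1 => c.active k

/-- A type is a list of colors; the tensor of types is concatenation, the unit is `[]`. -/
abbrev StreamType : Type := List Color

/-- The delay modality on types. -/
abbrev delayType (a : StreamType) : StreamType := a.map Color.delay

/-- `n` parallel wires of color `c`. -/
abbrev copies (n : ℕ) (c : Color) : StreamType := List.replicate n c

/-! ### Diagrams and their equational theory -/

section Terms

variable (G : Type u) [Category.{v} G] [MonoidalCategory G] [SymmetricCategory G]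
  [PropCategory G]

/-- Diagrams of the stream language over the prop `G`. For a color `c = D^j 1` (resp. `c = D^j ω`)
and a morphism `g : n ⟶ m` of `G`, the diagram `gen c g` is `D^j g` (resp. `D^j ω g`). -/
inductive Diagram : StreamType → StreamType → Type v
  | id (a : StreamType) : Diagram a a
  | comp {a b c : StreamType} (f : Diagram a b) (g : Diagram b c) : Diagram a c
  | tensor {a b c d : StreamType} (f : Diagram a b) (g : Diagram c d) :
      Diagram (a ++ c) (b ++ d)
  | swap (a b : StreamType) : Diagram (a ++ b) (b ++ a)
  | gen (c : Color) {n m : ℕ} (g : wires G n ⟶ wires G m) : Diagram (copies n c) (copies m c)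
  /-- stream derivative, delayed `j` times -/
  | deriv (j : ℕ) : Diagram [Color.delayed j .omega]
      [Color.delayed j .one, Color.delayed (j + 1) .omega]
  /-- stream initialization, delayed `j` times -/
  | init (j : ℕ) : Diagram [Color.delayed j .one, Color.delayed (j + 1) .omega]
      [Color.delayed j .omega]
  /-- delayed trace -/
  | dtrace {a b : StreamType} (c : StreamType) (f : Diagram (a ++ delayType c) (b ++ c)) :
      Diagram a b

variable {G}

namespace Diagram

/-- Transport along equalities of types. -/
def cast {a b a' b' : StreamType} (ha : a = a') (hb : b = b') (f : Diagram G a b) :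
    Diagram G a' b' :=
  hb ▸ ha ▸ f

/-- The delay endofunctor on diagrams. -/
def delay : {a b : StreamType} → Diagram G a b → Diagram G (delayType a) (delayType b)
  | _, _, .id a => .id (delayType a)
  | _, _, .comp f g => .comp f.delay g.delay
  | _, _, .tensor f g =>
      cast (by simp [delayType]) (by simp [delayType]) (.tensor f.delay g.delay)
  | _, _, .swap a b =>
      cast (by simp [delayType]) (by simp [delayType]) (.swap (delayType a) (delayType b))
  | _, _, .gen c g =>
      cast (by simp [delayType, copies]) (by simp [delayType, copies])
        (.gen (Color.delay c) g)
  | _, _, .deriv j => .deriv (j + 1)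
  | _, _, .init j => .init (j + 1)
  | _, _, .dtrace c f =>
      .dtrace (delayType c) (cast (by simp [delayType]) (by simp [delayType]) f.delay)

/-- The delay `a ⟶ D a`: the delayed trace of the swap. -/
def delayMap (a : StreamType) : Diagram G a (delayType a) :=
  .dtrace a (.swap a (delayType a))

/-- The `n`-fold stream initialization `n + n Dω ⟶ nω`. -/
def initN : (n : ℕ) →
    Diagram G (copies n .one ++ copies n (.delay .omega)) (copies n .omega)
  | 0 => .id []
  | n + 1 =>
      .comp
        (cast (a' := copies (n + 1) .one ++ copies (n + 1) (.delay .omega))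
          (b' := [.one, .delay .omega] ++ (copies n .one ++ copies n (.delay .omega)))
          (by simp [copies, List.replicate_succ]) (by simp [copies])
          (.tensor (.id [.one])
            (.tensor (.swap (copies n .one) [.delay .omega])
              (.id (copies n (.delay .omega))))))
        (.tensor (.init 0) (initN n))

end Diagram

open Diagram

variable [DiscardCategory G]

variable (G) in
/-- An equation between two parallel diagrams. -/
structure Equation where
  dom : StreamType
  cod : StreamType
  lhs : Diagram G dom cod
  rhs : Diagram G dom cod

/-- The axioms of the stream language, apart from the coinduction rule. The last constructor makes
every axiom available in all delayed versions. -/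
inductive StreamAxiom : {a b : StreamType} → Diagram G a b → Diagram G a b → Prop
  -- colored prop (strict symmetric monoidal category)
  | id_comp {a b} (f : Diagram G a b) : StreamAxiom (.comp (.id a) f) f
  | comp_id {a b} (f : Diagram G a b) : StreamAxiom (.comp f (.id b)) f
  | comp_assoc {a b c d} (f : Diagram G a b) (g : Diagram G b c) (h : Diagram G c d) :
      StreamAxiom (.comp (.comp f g) h) (.comp f (.comp g h))
  | tensor_id (a b : StreamType) : StreamAxiom (.tensor (.id a) (.id b)) (.id (a ++ b))
  | tensor_comp {a b c a' b' c'} (f : Diagram G a b) (g : Diagram G b c)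
      (f' : Diagram G a' b') (g' : Diagram G b' c') :
      StreamAxiom (.tensor (.comp f g) (.comp f' g')) (.comp (.tensor f f') (.tensor g g'))
  | tensor_assoc {a b c d e e'} (f : Diagram G a b) (g : Diagram G c d) (h : Diagram G e e') :
      StreamAxiom (Diagram.cast (List.append_assoc _ _ _) (List.append_assoc _ _ _)
        (.tensor (.tensor f g) h)) (.tensor f (.tensor g h))
  | unit_tensor {a b} (f : Diagram G a b) : StreamAxiom (.tensor (.id []) f) f
  | tensor_unit {a b} (f : Diagram G a b) :
      StreamAxiom (Diagram.cast (List.append_nil _) (List.append_nil _) (.tensor f (.id []))) f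
  | swap_natural {a b c d} (f : Diagram G a b) (g : Diagram G c d) :
      StreamAxiom (.comp (.tensor f g) (.swap b d)) (.comp (.swap a c) (.tensor g f))
  | swap_swap (a b : StreamType) :
      StreamAxiom (.comp (.swap a b) (.swap b a)) (.id (a ++ b))
  | swap_tensor (a b c : StreamType) :
      StreamAxiom (.swap a (b ++ c))
        (.comp
          (Diagram.cast (List.append_assoc _ _ _) (List.append_assoc _ _ _)
            (.tensor (.swap a b) (.id c)))
          (Diagram.cast rfl (List.append_assoc _ _ _).symm (.tensor (.id b) (.swap a c))))
  -- every color gives a symmetric monoidal functor from the base prop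
  | gen_id (c : Color) (n : ℕ) : StreamAxiom (.gen c (𝟙 (wires G n))) (.id (copies n c))
  | gen_comp (c : Color) {n m l : ℕ} (f : wires G n ⟶ wires G m) (g : wires G m ⟶ wires G l) :
      StreamAxiom (.gen c (f ≫ g)) (.comp (.gen c f) (.gen c g))
  | gen_tensor (c : Color) {n m n' m' : ℕ} (f : wires G n ⟶ wires G m)
      (g : wires G n' ⟶ wires G m') :
      StreamAxiom
        (.gen c (eqToHom (PropCategory.wires_add n n') ≫ (f ⊗ₘ g) ≫
          eqToHom (PropCategory.wires_add m m').symm))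
        (Diagram.cast List.replicate_append_replicate List.replicate_append_replicate
          (.tensor (.gen c f) (.gen c g)))
  | gen_swap (c : Color) (n m : ℕ) :
      StreamAxiom
        (.gen c (eqToHom (PropCategory.wires_add n m) ≫ (β_ (wires G n) (wires G m)).hom ≫
          eqToHom (PropCategory.wires_add m n).symm))
        (Diagram.cast List.replicate_append_replicate List.replicate_append_replicate
          (.swap (copies n c) (copies m c)))
  -- derivative and initialization
  | deriv_init : StreamAxiom (.comp (.deriv 0) (.init 0)) (.id [Color.omega])
  | init_deriv : StreamAxiom (.comp (.init 0) (.deriv 0)) (.id [Color.one, .delay .omega])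
  | init_gen {n m : ℕ} (g : wires G n ⟶ wires G m) :
      StreamAxiom (.comp (initN n) (.gen .omega g))
        (.comp (.tensor (.gen .one g) (.gen (.delay .omega) g)) (initN m))
  -- delayed trace
  | dtrace_pre {a' a b c} (h : Diagram G a' a) (f : Diagram G (a ++ delayType c) (b ++ c)) :
      StreamAxiom (.dtrace c (.comp (.tensor h (.id (delayType c))) f))
        (.comp h (.dtrace c f))
  | dtrace_post {a b b' c} (f : Diagram G (a ++ delayType c) (b ++ c)) (h : Diagram G b b') :
      StreamAxiom (.dtrace c (.comp f (.tensor h (.id c)))) (.comp (.dtrace c f) h)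
  | dtrace_tensor {a b c} (e : StreamType) (f : Diagram G (a ++ delayType c) (b ++ c)) :
      StreamAxiom (.tensor (.id e) (.dtrace c f))
        (.dtrace c (Diagram.cast (List.append_assoc _ _ _).symm (List.append_assoc _ _ _).symm
          (.tensor (.id e) f)))
  | dtrace_dtrace {a b c d}
      (f : Diagram G ((a ++ delayType c) ++ delayType d) ((b ++ c) ++ d)) :
      StreamAxiom (.dtrace c (.dtrace d f))
        (.dtrace (c ++ d) (Diagram.cast (by simp [delayType]) (by simp) f))
  | dtrace_unit {a b} (f : Diagram G (a ++ delayType []) (b ++ [])) :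
      StreamAxiom (.dtrace [] f)
        (Diagram.cast (List.append_nil _) (List.append_nil _) f)
  -- the delay commutes with derivatives, initializations, swaps and causal maps
  | delay_deriv :
      StreamAxiom (.comp (.deriv 0) (delayMap [Color.one, .delay .omega]))
        (.comp (delayMap [Color.omega]) (.deriv 1))
  | delay_init :
      StreamAxiom (.comp (.init 0) (delayMap [Color.omega]))
        (.comp (delayMap [Color.one, .delay .omega]) (.init 1))
  | delay_swap (a b : StreamType) :
      StreamAxiom (.comp (.swap a b) (delayMap (b ++ a)))
        (.comp (delayMap (a ++ b)) (Diagram.swap a b).delay)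
  | delay_causal {n m : ℕ} (g : wires G n ⟶ wires G m) (hg : IsCausal g) :
      StreamAxiom (.comp (.gen .one g) (delayMap (copies m .one)))
        (.comp (delayMap (copies n .one)) (Diagram.gen .one g).delay)
  -- an idempotent can be copied through the delay
  | delay_idem {n : ℕ} (p : wires G n ⟶ wires G n) (hp : p ≫ p = p) :
      StreamAxiom (.comp (.gen .one p) (delayMap (copies n .one)))
        (.comp (.comp (.gen .one p) (delayMap (copies n .one))) (Diagram.gen .one p).delay)
  | delay {a b} {f g : Diagram G a b} (h : StreamAxiom f g) : StreamAxiom f.delay g.delay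

/-- Derivability of an equation from the axioms and a set of hypotheses, including the coinduction
rule. -/
inductive Derivable : Set (Equation G) → {a b : StreamType} →
    Diagram G a b → Diagram G a b → Prop
  | hyp {Γ : Set (Equation G)} (e : Equation G) (he : e ∈ Γ) : Derivable Γ e.lhs e.rhs
  | ax {Γ : Set (Equation G)} {a b} {f g : Diagram G a b} (h : StreamAxiom f g) :
      Derivable Γ f g
  | refl {Γ : Set (Equation G)} {a b} (f : Diagram G a b) : Derivable Γ f f
  | symm {Γ : Set (Equation G)} {a b} {f g : Diagram G a b} (h : Derivable Γ f g) :
      Derivable Γ g f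
  | trans {Γ : Set (Equation G)} {a b} {f g h : Diagram G a b} (h₁ : Derivable Γ f g)
      (h₂ : Derivable Γ g h) : Derivable Γ f h
  | comp {Γ : Set (Equation G)} {a b c} {f f' : Diagram G a b} {g g' : Diagram G b c}
      (h₁ : Derivable Γ f f') (h₂ : Derivable Γ g g') :
      Derivable Γ (.comp f g) (.comp f' g')
  | tensor {Γ : Set (Equation G)} {a b c d} {f f' : Diagram G a b} {g g' : Diagram G c d}
      (h₁ : Derivable Γ f f') (h₂ : Derivable Γ g g') :
      Derivable Γ (.tensor f g) (.tensor f' g')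
  | dtrace {Γ : Set (Equation G)} {a b c} {f f' : Diagram G (a ++ delayType c) (b ++ c)}
      (h : Derivable Γ f f') : Derivable Γ (.dtrace c f) (.dtrace c f')
  | coind {Γ : Set (Equation G)} (a b : ℕ → StreamType) (S T : ∀ n, Diagram G (a n) (b n))
      (h : ∀ n, Derivable
        (insert ⟨delayType (a (n + 1)), delayType (b (n + 1)), (S (n + 1)).delay,
          (T (n + 1)).delay⟩ Γ) (S n) (T n)) :
      Derivable Γ (S 0) (T 0)

/-- Morphisms of the stream language: diagrams up to derivable equality. -/
def StreamHom (G : Type u) [Category.{v} G] [MonoidalCategory G] [SymmetricCategory G]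
    [PropCategory G] [DiscardCategory G] (a b : StreamType) : Type v :=
  Quot (fun f g : Diagram G a b => Derivable ∅ f g)

/-- The morphism presented by a diagram. -/
def Diagram.toHom {a b : StreamType} (f : Diagram G a b) : StreamHom G a b :=
  Quot.mk _ f

end Terms

/-! ### Stateful morphism sequences -/

section Stateful

variable {M : Type u} [Category.{v} M] [MonoidalCategory M]

/-- The sequence shifted by one tick, starting with the unit object. -/
def prev (m : ℕ → M) : ℕ → M
  | 0 => 𝟙_ M
  | k + 1 => m k

/-- Stateful morphism sequences: `mem k` is the memory left after tick `k`, so that `prev mem k` is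
the memory available at tick `k` (nothing at the first tick). -/
structure StatefulSeq (a b : ℕ → M) where
  mem : ℕ → M
  layer (k : ℕ) : a k ⊗ prev mem k ⟶ b k ⊗ mem k

/-- `I ≅ I ⊗ I` at the first tick, and the identity afterwards. -/
def prevTensor (m n : ℕ → M) : ∀ k, prev (fun i => m i ⊗ n i) k ≅ prev m k ⊗ prev n k
  | 0 => (λ_ (𝟙_ M)).symm
  | _ + 1 => Iso.refl _

/-- The previous memory of a memoryless sequence is trivial. -/
def prevUnit : ∀ k, prev (fun _ => 𝟙_ M) k ≅ 𝟙_ M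
  | 0 => Iso.refl _
  | _ + 1 => Iso.refl _

namespace StatefulSeq

/-- A memoryless sequence. -/
def ofHoms {a b : ℕ → M} (g : ∀ k, a k ⟶ b k) : StatefulSeq a b where
  mem _ := 𝟙_ M
  layer k := g k ⊗ₘ (prevUnit k).hom

/-- Transport along equalities of the objects at each tick. -/
def cast {a b a' b' : ℕ → M} (ha : ∀ k, a' k = a k) (hb : ∀ k, b k = b' k)
    (f : StatefulSeq a b) : StatefulSeq a' b' where
  mem := f.mem
  layer k := eqToHom (ha k) ▷ _ ≫ f.layer k ≫ eqToHom (hb k) ▷ _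

variable [SymmetricCategory M]

/-- Composition: layers are composed, memories are put side by side. -/
def comp {a b c : ℕ → M} (f : StatefulSeq a b) (g : StatefulSeq b c) : StatefulSeq a c where
  mem k := f.mem k ⊗ g.mem k
  layer k :=
    a k ◁ (prevTensor f.mem g.mem k).hom ≫ (α_ _ _ _).inv ≫ f.layer k ▷ _ ≫
      (α_ _ _ _).hom ≫ b k ◁ (β_ _ _).hom ≫ (α_ _ _ _).inv ≫ g.layer k ▷ _ ≫
      (α_ _ _ _).hom ≫ c k ◁ (β_ _ _).hom

/-- Tensor product: layers and memories are put side by side. -/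
def tensor {a b c d : ℕ → M} (f : StatefulSeq a b) (g : StatefulSeq c d) :
    StatefulSeq (fun k => a k ⊗ c k) (fun k => b k ⊗ d k) where
  mem k := f.mem k ⊗ g.mem k
  layer k :=
    (a k ⊗ c k) ◁ (prevTensor f.mem g.mem k).hom ≫ tensorμ _ _ _ _ ≫
      (f.layer k ⊗ₘ g.layer k) ≫ tensorμ _ _ _ _

/-- Delayed trace: the output `c k` of tick `k` is kept in memory and fed back at tick `k + 1`. -/
def dtrace {a b : ℕ → M} (c : ℕ → M)
    (f : StatefulSeq (fun k => a k ⊗ prev c k) (fun k => b k ⊗ c k)) : StatefulSeq a b where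
  mem k := c k ⊗ f.mem k
  layer k :=
    a k ◁ (prevTensor c f.mem k).hom ≫ (α_ _ _ _).inv ≫ f.layer k ≫ (α_ _ _ _).hom

end StatefulSeq

end Stateful

/-! ### Unfolding of diagrams into stateful morphism sequences -/

section Unfold

variable (G : Type u) [Category.{v} G] [MonoidalCategory G] [SymmetricCategory G]
  [PropCategory G]

/-- The object of `G` sent by a type at tick `k`: one wire for each color sending data. -/
def typeAt (a : StreamType) (k : ℕ) : G :=
  wires G (a.countP (fun c => c.active k))

theorem typeAt_append (a b : StreamType) (k : ℕ) :
    typeAt G (a ++ b) k = typeAt G a k ⊗ typeAt G b k := by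
  simp [typeAt, PropCategory.wires_add]

theorem typeAt_delay (a : StreamType) (k : ℕ) :
    typeAt G (delayType a) k = prev (typeAt G a) k := by
  cases k with
  | zero =>
    have h : (delayType a).countP (fun c => c.active 0) = 0 := by
      simp [delayType, List.countP_eq_zero, Color.active]
    simp only [typeAt, h]
    exact PropCategory.wires_zero
  | succ k =>
    simp only [typeAt, prev, delayType, List.countP_map]
    rfl

theorem typeAt_append_delay (a c : StreamType) (k : ℕ) :
    typeAt G (a ++ delayType c) k = typeAt G a k ⊗ prev (typeAt G c) k := by
  rw [typeAt_append, typeAt_delay]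

theorem typeAt_copies_of_active {c : Color} {k : ℕ} (h : c.active k = true) (n : ℕ) :
    typeAt G (copies n c) k = wires G n := by
  simp [typeAt, List.countP_replicate, h]

theorem typeAt_copies_of_not_active {c : Color} {k : ℕ} (h : ¬ c.active k = true) (n m : ℕ) :
    typeAt G (copies n c) k = typeAt G (copies m c) k := by
  simp [typeAt, List.countP_replicate, h]

theorem Color.active_delayed_eq (j k : ℕ) :
    (Color.delayed j .omega).active k =
      ((Color.delayed j .one).active k || (Color.delayed (j + 1) .omega).active k) ∧
    ((Color.delayed j .one).active k && (Color.delayed (j + 1) .omega).active k) = false := by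
  induction j generalizing k with
  | zero => cases k <;> simp [Color.delayed, Color.active]
  | succ j ih =>
    cases k with
    | zero => simp [Color.delayed, Color.active]
    | succ k => exact ih k

/-- A stream and its derivative send the same data at each tick. -/
theorem typeAt_deriv (j k : ℕ) :
    typeAt G [Color.delayed j .omega] k =
      typeAt G [Color.delayed j .one, Color.delayed (j + 1) .omega] k := by
  have h := Color.active_delayed_eq j k
  refine congrArg (wires G) ?_
  cases h₁ : (Color.delayed j .one).active k <;>
    cases h₂ : (Color.delayed (j + 1) .omega).active k <;>
      simp_all

variable {G}

/-- The stateful morphism sequence of a diagram. A generator `gen c g` acts as `g` at the ticks at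
which `c` sends data and does nothing at the other ticks. -/
def unfold : {a b : StreamType} → Diagram G a b → StatefulSeq (typeAt G a) (typeAt G b)
  | _, _, .id _ => .ofHoms fun _ => 𝟙 _
  | _, _, .comp f g => (unfold f).comp (unfold g)
  | _, _, .tensor f g =>
      ((unfold f).tensor (unfold g)).cast (typeAt_append G _ _)
        (fun k => (typeAt_append G _ _ k).symm)
  | _, _, .swap a b =>
      StatefulSeq.cast (typeAt_append G _ _) (fun k => (typeAt_append G _ _ k).symm)
        (.ofHoms fun k => (β_ (typeAt G a k) (typeAt G b k)).hom)
  | _, _, .gen (n := n) (m := m) c g =>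
      .ofHoms fun k =>
        if h : c.active k = true then
          eqToHom (typeAt_copies_of_active G h n) ≫ g ≫
            eqToHom (typeAt_copies_of_active G h m).symm
        else eqToHom (typeAt_copies_of_not_active G h n m)
  | _, _, .deriv j => .ofHoms fun k => eqToHom (typeAt_deriv G j k)
  | _, _, .init j => .ofHoms fun k => eqToHom (typeAt_deriv G j k).symm
  | _, _, .dtrace c f =>
      .dtrace (typeAt G c)
        ((unfold f).cast (fun k => (typeAt_append_delay G _ _ k).symm)
          (fun k => typeAt_append G _ _ k))

end Unfold

/-! ### Finite approximations -/

section Approximation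

variable {C : Type u'} [Category.{v'} C] [MonoidalCategory C]

/-- The product `A 0 ⊗ ... ⊗ A k`, bracketed to the left. -/
def prod (A : ℕ → C) : ℕ → C
  | 0 => A 0
  | k + 1 => prod A k ⊗ A (k + 1)

section MapSeq

variable {G : Type u} [Category.{v} G] [MonoidalCategory G]

/-- The comparison between previous memories: `I ⟶ F I` at the first tick. -/
def prevMap (F : G ⥤ C) [F.Monoidal] (m : ℕ → G) :
    ∀ k, prev (fun i => F.obj (m i)) k ⟶ F.obj (prev m k)
  | 0 => Functor.LaxMonoidal.ε F
  | _ + 1 => 𝟙 _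

/-- A monoidal functor applied to every layer of a stateful morphism sequence. -/
def StatefulSeq.map (F : G ⥤ C) [F.Monoidal] {a b : ℕ → G} (f : StatefulSeq a b) :
    StatefulSeq (fun k => F.obj (a k)) (fun k => F.obj (b k)) where
  mem k := F.obj (f.mem k)
  layer k :=
    F.obj (a k) ◁ prevMap F f.mem k ≫ Functor.LaxMonoidal.μ F _ _ ≫ F.map (f.layer k) ≫
      Functor.OplaxMonoidal.δ F _ _

end MapSeq

variable [SymmetricCategory C]

/-- The layers up to tick `k` plugged together along the memories, the last memory being kept as an
output. -/
def StatefulSeq.openApprox {A B : ℕ → C} (f : StatefulSeq A B) :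
    ∀ k, prod A k ⟶ prod B k ⊗ f.mem k
  | 0 => (ρ_ (A 0)).inv ≫ f.layer 0
  | k + 1 =>
      f.openApprox k ▷ A (k + 1) ≫ (α_ _ _ _).hom ≫
        prod B k ◁ ((β_ (f.mem k) (A (k + 1))).hom ≫ f.layer (k + 1)) ≫ (α_ _ _ _).inv

variable [DiscardCategory C]

/-- The finite approximation at tick `k`: the last memory is discarded. -/
def StatefulSeq.approx {A B : ℕ → C} (f : StatefulSeq A B) (k : ℕ) : prod A k ⟶ prod B k :=
  f.openApprox k ≫ prod B k ◁ ground (f.mem k) ≫ (ρ_ _).hom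

/-- `f ≼ g`: `f` is obtained from a morphism `g₀` with `g = discard ∘ g₀` by replacing the discard
by some effect `f₀`. -/
def Refines {A B : C} (f g : A ⟶ B) : Prop :=
  ∃ (X : C) (g₀ : A ⟶ B ⊗ X) (f₀ : X ⟶ 𝟙_ C),
    f = g₀ ≫ B ◁ f₀ ≫ (ρ_ B).hom ∧ g = g₀ ≫ B ◁ ground X ≫ (ρ_ B).hom

/-- `X ⊗ Y ⊗ ... ⊗ Y` with `j` copies of `Y`, bracketed to the left. -/
def pad (X Y : C) : ℕ → C
  | 0 => X
  | j + 1 => pad X Y j ⊗ Y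

/-- The object part of finite approximation sequences: a sequence of objects of `C` that is monotone
(with chosen factors `next k`) and regular. -/
structure FAObject (A : ℕ → C) where
  next : ℕ → C
  monotone (k : ℕ) : A (k + 1) = A k ⊗ next k
  regular : ∃ (n : ℕ) (A' : C), ∀ j, A (n + j) = pad (A n) A' j

/-- Monotone sequences of morphisms: discarding the new output of `g (k + 1)` refines `g k` together
with discarding the new input. -/
def IsMonotone {A B : ℕ → C} (S : FAObject A) (T : FAObject B) (g : ∀ k, A k ⟶ B k) : Prop :=
  ∀ k, Refines
    (eqToHom (S.monotone k).symm ≫ g (k + 1) ≫ eqToHom (T.monotone k) ≫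
      B k ◁ ground (T.next k) ≫ (ρ_ (B k)).hom)
    (A k ◁ ground (S.next k) ≫ (ρ_ (A k)).hom ≫ g k)

/-- An irregular part `gi` followed by `j` copies of the regular part `gr`, plugged along `M`. -/
def regularOpen {A₀ B₀ A' B' M : C} (gi : A₀ ⟶ B₀ ⊗ M) (gr : M ⊗ A' ⟶ B' ⊗ M) :
    ∀ j, pad A₀ A' j ⟶ pad B₀ B' j ⊗ M
  | 0 => gi
  | j + 1 =>
      regularOpen gi gr j ▷ A' ≫ (α_ _ _ _).hom ≫ pad B₀ B' j ◁ gr ≫ (α_ _ _ _).inv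

/-- Regular sequences of morphisms. -/
def IsRegular {A B : ℕ → C} (g : ∀ k, A k ⟶ B k) : Prop :=
  ∃ (n : ℕ) (A' B' M : C) (hA : ∀ j, A (n + j) = pad (A n) A' j)
    (hB : ∀ j, B (n + j) = pad (B n) B' j)
    (gi : A n ⟶ B n ⊗ M) (gr : M ⊗ A' ⟶ B' ⊗ M),
    ∀ j, g (n + j) = eqToHom (hA j) ≫ regularOpen gi gr j ≫
      pad (B n) B' j ◁ ground M ≫ (ρ_ _).hom ≫ eqToHom (hB j).symm

/-- Membership of a sequence of morphisms in the category of finite approximation sequences. -/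
def IsFiniteApprox {A B : ℕ → C} (S : FAObject A) (T : FAObject B) (g : ∀ k, A k ⟶ B k) :
    Prop :=
  IsMonotone S T g ∧ IsRegular g

end Approximation

/-! ### The semantics -/

section Semantics

variable {G : Type u} [Category.{v} G] [MonoidalCategory G] [SymmetricCategory G]
  [PropCategory G] {C : Type u'} [Category.{v'} C] [MonoidalCategory C]

/-- Semantics of types. -/
def semType (F : G ⥤ C) (a : StreamType) : ℕ → C :=
  prod fun k => F.obj (typeAt G a k)

variable [SymmetricCategory C] [DiscardCategory C]

/-- Semantics of diagrams: the finite approximations of the interpretation of the stateful morphism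
sequence of the diagram. -/
def sem (F : G ⥤ C) [F.Monoidal] {a b : StreamType} (D : Diagram G a b) :
    ∀ k, semType F a k ⟶ semType F b k :=
  ((unfold D).map F).approx

end Semantics

end StreamLang

open CategoryTheory StreamLang

open CategoryTheory MonoidalCategory Filter

namespace StreamLang

universe v u v' u'

/-! ### Stationary sequences -/

/-! The two properties have different sources. Monotonicity holds for every stateful morphism
sequence: after `k` ticks the memory can either be discarded together with the next input, or be fed
with it to layer `k + 1` whose outputs are then all discarded, and these are two effects on the same
wires (`refines_step`). Regularity comes from stationarity. A diagram is finite and each color is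
eventually always or never active, so by structural induction the memories and layers of its
unfolding are eventually constant (`isStationary_unfold`), and a functor preserves this. From such a
rank `n` on, the same layer is plugged in again and again: it is the regular part, and the composite
of the layers up to `n` is the irregular part (`StatefulSeq.isRegular_approx`). Objects at
consecutive ticks are equal without being definitionally equal, so layers are compared by `HEq`.
Only layers of index at least 1 are compared: there `prev m (k + 1)` is `m k` by definition, and the
coherence maps special to the first tick are identities. -/

/-- A sequence is stationary if consecutive values agree from some rank on. -/
def Stationary {α : Type*} (a : ℕ → α) : Prop :=
  ∀ᶠ k in atTop, a (k + 1) = a k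

theorem eventually_succ {p : ℕ → Prop} (h : ∀ᶠ k in atTop, p k) : ∀ᶠ k in atTop, p (k + 1) :=
  (tendsto_add_atTop_nat 1).eventually h

theorem Stationary.map {α β : Type*} {a : ℕ → α} (h : Stationary a) (φ : α → β) :
    Stationary fun k => φ (a k) :=
  Eventually.mono h fun _ hk => congrArg φ hk

theorem Stationary.map₂ {α β γ : Type*} {a : ℕ → α} {b : ℕ → β} (ha : Stationary a)
    (hb : Stationary b) (φ : α → β → γ) : Stationary fun k => φ (a k) (b k) := by
  filter_upwards [ha, hb] with k h₁ h₂
  rw [h₁, h₂]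

/-- Activity is constant from index 1 for `one` and from index 0 for `omega`; each delay raises the
rank by one. -/
theorem Color.stationary_active (c : Color) : Stationary c.active := by
  induction c with
  | one => exact eventually_atTop.2 ⟨1, fun k hk => by cases k <;> simp_all [Color.active]⟩
  | omega => exact Eventually.of_forall fun k => rfl
  | delay c ih =>
    obtain ⟨n, hn⟩ := eventually_atTop.1 ih
    refine eventually_atTop.2 ⟨n + 1, fun k hk => ?_⟩
    obtain _ | k := k
    · omega
    · exact hn k (by omega)

theorem stationary_typeAt (G : Type u) [Category.{v} G] [MonoidalCategory G]
    [SymmetricCategory G] [PropCategory G] (a : StreamType) : Stationary (typeAt G a) := by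
  refine Stationary.map (a := fun k => a.countP fun c => c.active k) ?_ (wires G)
  induction a with
  | nil => exact Eventually.of_forall fun k => rfl
  | cons c a ih =>
    filter_upwards [ih, c.stationary_active] with k h₁ h₂
    simp only [List.countP_cons, h₁, h₂]

/-! ### Stationary stateful morphism sequences -/

namespace StatefulSeq

section Layers

variable {M : Type u} [Category.{v} M] [MonoidalCategory M]

/-- The memories and the layers of a stateful morphism sequence agree from some rank on. -/
def IsStationary {a b : ℕ → M} (f : StatefulSeq a b) : Prop :=
  Stationary f.mem ∧ ∀ᶠ k in atTop, f.layer (k + 2) ≍ f.layer (k + 1)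

/-- Pattern of all the `_layer_heq` lemmas: with every object a free variable, the equalities
between consecutive objects can be substituted, after which the two layers coincide. -/
theorem cast_layer_heq {A B A' B' A₂ B₂ A₂' B₂' P Q P₂ Q₂ : M}
    (hA : A' = A) (hB : B = B') (hA₂ : A₂' = A₂) (hB₂ : B₂ = B₂')
    {f : A ⊗ P ⟶ B ⊗ Q} {f₂ : A₂ ⊗ P₂ ⟶ B₂ ⊗ Q₂}
    (eA : A₂ = A) (eB : B₂ = B) (eP : P₂ = P) (eQ : Q₂ = Q) (hf : f₂ ≍ f) :
    eqToHom hA₂ ▷ P₂ ≫ f₂ ≫ eqToHom hB₂ ▷ Q₂ ≍ eqToHom hA ▷ P ≫ f ≫ eqToHom hB ▷ Q := by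
  subst eA eB eP eQ hA hB hA₂ hB₂
  subst hf
  rfl

theorem IsStationary.cast {a b a' b' : ℕ → M} {f : StatefulSeq a b} (hf : f.IsStationary)
    (ha : Stationary a) (hb : Stationary b) (ha' : ∀ k, a' k = a k) (hb' : ∀ k, b k = b' k) :
    (f.cast ha' hb').IsStationary := by
  refine ⟨hf.1, ?_⟩
  -- `m₁` identifies the incoming memories of layers `k + 2` and `k + 1`, `m₂` the outgoing ones.
  filter_upwards [hf.1, eventually_succ hf.1, hf.2, eventually_succ ha, eventually_succ hb]
    with k m₁ m₂ hl h₁ h₂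
  exact cast_layer_heq _ _ _ _ h₁ h₂ m₁ m₂ hl

theorem isStationary_ofHoms {a b : ℕ → M} (g : ∀ k, a k ⟶ b k) (ha : Stationary a)
    (hb : Stationary b) (hg : ∀ᶠ k in atTop, g (k + 1) ≍ g k) :
    (ofHoms g).IsStationary := by
  refine ⟨Eventually.of_forall fun _ => rfl, ?_⟩
  filter_upwards [eventually_succ ha, eventually_succ hb, eventually_succ hg] with k h₁ h₂ h₃
  -- Away from the first tick, `prevUnit` is the identity by definition.
  change g (k + 2) ⊗ₘ 𝟙 (𝟙_ M) ≍ g (k + 1) ⊗ₘ 𝟙 (𝟙_ M)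
  revert h₃
  generalize g (k + 2) = x
  generalize g (k + 1) = y
  revert x y
  rw [h₁, h₂]
  rintro x y ⟨⟩
  rfl

/-- `Iso.refl` is the value of `prevTensor` at a successor index, so the expression unfolds to the
actual layer of the trace. -/
theorem dtrace_layer_heq {A B P C D Q A₂ B₂ P₂ C₂ D₂ Q₂ : M}
    {f : (A ⊗ C) ⊗ P ⟶ (B ⊗ D) ⊗ Q} {f₂ : (A₂ ⊗ C₂) ⊗ P₂ ⟶ (B₂ ⊗ D₂) ⊗ Q₂}
    (eA : A₂ = A) (eB : B₂ = B) (eC : C₂ = C) (eD : D₂ = D) (eP : P₂ = P) (eQ : Q₂ = Q)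
    (hf : f₂ ≍ f) :
    A₂ ◁ (Iso.refl (C₂ ⊗ P₂)).hom ≫ (α_ _ _ _).inv ≫ f₂ ≫ (α_ _ _ _).hom ≍
      A ◁ (Iso.refl (C ⊗ P)).hom ≫ (α_ _ _ _).inv ≫ f ≫ (α_ _ _ _).hom := by
  subst eA eB eC eD eP eQ
  subst hf
  rfl

theorem IsStationary.dtrace {a b c : ℕ → M}
    {f : StatefulSeq (fun k => a k ⊗ prev c k) (fun k => b k ⊗ c k)} (hf : f.IsStationary)
    (ha : Stationary a) (hb : Stationary b) (hc : Stationary c) :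
    (f.dtrace c).IsStationary := by
  refine ⟨hc.map₂ hf.1 fun X Y => X ⊗ Y, ?_⟩
  -- Stationarity of `c` is needed at two consecutive ranks: layer `k + 1` receives `c k` and emits
  -- `c (k + 1)`.
  filter_upwards [hf.1, eventually_succ hf.1, hf.2, eventually_succ ha, eventually_succ hb, hc,
    eventually_succ hc] with k m₁ m₂ hl h₁ h₂ h₃ h₄
  exact dtrace_layer_heq h₁ h₂ h₃ h₄ m₁ m₂ hl

variable [SymmetricCategory M]

theorem comp_layer_heq {A B C P P' Q Q' A₂ B₂ C₂ P₂ P₂' Q₂ Q₂' : M}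
    {f : A ⊗ P ⟶ B ⊗ P'} {g : B ⊗ Q ⟶ C ⊗ Q'}
    {f₂ : A₂ ⊗ P₂ ⟶ B₂ ⊗ P₂'} {g₂ : B₂ ⊗ Q₂ ⟶ C₂ ⊗ Q₂'}
    (eA : A₂ = A) (eB : B₂ = B) (eC : C₂ = C) (eP : P₂ = P) (eP' : P₂' = P')
    (eQ : Q₂ = Q) (eQ' : Q₂' = Q') (hf : f₂ ≍ f) (hg : g₂ ≍ g) :
    A₂ ◁ (Iso.refl (P₂ ⊗ Q₂)).hom ≫ (α_ _ _ _).inv ≫ f₂ ▷ _ ≫ (α_ _ _ _).hom ≫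
        B₂ ◁ (β_ _ _).hom ≫ (α_ _ _ _).inv ≫ g₂ ▷ _ ≫ (α_ _ _ _).hom ≫
        C₂ ◁ (β_ _ _).hom ≍
      A ◁ (Iso.refl (P ⊗ Q)).hom ≫ (α_ _ _ _).inv ≫ f ▷ _ ≫ (α_ _ _ _).hom ≫
        B ◁ (β_ _ _).hom ≫ (α_ _ _ _).inv ≫ g ▷ _ ≫ (α_ _ _ _).hom ≫
        C ◁ (β_ _ _).hom := by
  subst eA eB eC eP eP' eQ eQ'
  subst hf hg
  rfl

theorem IsStationary.comp {a b c : ℕ → M} {f : StatefulSeq a b} {g : StatefulSeq b c}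
    (hf : f.IsStationary) (hg : g.IsStationary) (ha : Stationary a) (hb : Stationary b)
    (hc : Stationary c) : (f.comp g).IsStationary := by
  refine ⟨hf.1.map₂ hg.1 fun X Y => X ⊗ Y, ?_⟩
  filter_upwards [hf.1, eventually_succ hf.1, hf.2, hg.1, eventually_succ hg.1, hg.2,
    eventually_succ ha, eventually_succ hb, eventually_succ hc]
    with k m₁ m₂ hl n₁ n₂ hl' h₁ h₂ h₃
  exact comp_layer_heq h₁ h₂ h₃ m₁ m₂ n₁ n₂ hl hl'

theorem tensor_layer_heq {A B C D P P' Q Q' A₂ B₂ C₂ D₂ P₂ P₂' Q₂ Q₂' : M}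
    {f : A ⊗ P ⟶ B ⊗ P'} {g : C ⊗ Q ⟶ D ⊗ Q'}
    {f₂ : A₂ ⊗ P₂ ⟶ B₂ ⊗ P₂'} {g₂ : C₂ ⊗ Q₂ ⟶ D₂ ⊗ Q₂'}
    (eA : A₂ = A) (eB : B₂ = B) (eC : C₂ = C) (eD : D₂ = D) (eP : P₂ = P) (eP' : P₂' = P')
    (eQ : Q₂ = Q) (eQ' : Q₂' = Q') (hf : f₂ ≍ f) (hg : g₂ ≍ g) :
    (A₂ ⊗ C₂) ◁ (Iso.refl (P₂ ⊗ Q₂)).hom ≫ tensorμ _ _ _ _ ≫ (f₂ ⊗ₘ g₂) ≫ tensorμ _ _ _ _ ≍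
      (A ⊗ C) ◁ (Iso.refl (P ⊗ Q)).hom ≫ tensorμ _ _ _ _ ≫ (f ⊗ₘ g) ≫ tensorμ _ _ _ _ := by
  subst eA eB eC eD eP eP' eQ eQ'
  subst hf hg
  rfl

theorem IsStationary.tensor {a b c d : ℕ → M} {f : StatefulSeq a b} {g : StatefulSeq c d}
    (hf : f.IsStationary) (hg : g.IsStationary) (ha : Stationary a) (hb : Stationary b)
    (hc : Stationary c) (hd : Stationary d) : (f.tensor g).IsStationary := by
  refine ⟨hf.1.map₂ hg.1 fun X Y => X ⊗ Y, ?_⟩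
  filter_upwards [hf.1, eventually_succ hf.1, hf.2, hg.1, eventually_succ hg.1, hg.2,
    eventually_succ ha, eventually_succ hb, eventually_succ hc, eventually_succ hd]
    with k m₁ m₂ hl n₁ n₂ hl' h₁ h₂ h₃ h₄
  exact tensor_layer_heq h₁ h₂ h₃ h₄ m₁ m₂ n₁ n₂ hl hl'

end Layers

/-! ### Stationarity under monoidal functors -/

section Map

variable {G : Type u} [Category.{v} G] [MonoidalCategory G]
  {C : Type u'} [Category.{v'} C] [MonoidalCategory C]

/-- The whiskered identity is the value of `prevMap` at a successor index. -/
theorem map_layer_heq (F : G ⥤ C) [F.Monoidal] {A B P Q A₂ B₂ P₂ Q₂ : G}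
    {f : A ⊗ P ⟶ B ⊗ Q} {f₂ : A₂ ⊗ P₂ ⟶ B₂ ⊗ Q₂}
    (eA : A₂ = A) (eB : B₂ = B) (eP : P₂ = P) (eQ : Q₂ = Q) (hf : f₂ ≍ f) :
    F.obj A₂ ◁ 𝟙 (F.obj P₂) ≫ Functor.LaxMonoidal.μ F _ _ ≫ F.map f₂ ≫
        Functor.OplaxMonoidal.δ F _ _ ≍
      F.obj A ◁ 𝟙 (F.obj P) ≫ Functor.LaxMonoidal.μ F _ _ ≫ F.map f ≫
        Functor.OplaxMonoidal.δ F _ _ := by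
  subst eA eB eP eQ
  subst hf
  rfl

theorem IsStationary.map {a b : ℕ → G} {f : StatefulSeq a b} (hf : f.IsStationary)
    (ha : Stationary a) (hb : Stationary b) (F : G ⥤ C) [F.Monoidal] :
    (f.map F).IsStationary := by
  refine ⟨hf.1.map F.obj, ?_⟩
  filter_upwards [hf.1, eventually_succ hf.1, hf.2, eventually_succ ha, eventually_succ hb]
    with k m₁ m₂ hl h₁ h₂
  exact map_layer_heq F h₁ h₂ m₁ m₂ hl

end Map

end StatefulSeq

/-! ### Diagrams unfold to stationary sequences -/

section Unfold

variable {G : Type u} [Category.{v} G] [MonoidalCategory G] [SymmetricCategory G]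
  [PropCategory G]

theorem eqToHom_heq_eqToHom {M : Type u} [Category.{v} M] {A B A' B' : M} (h : A = B)
    (h' : A' = B') (e : A = A') : eqToHom h ≍ eqToHom h' := by
  subst h h' e
  rfl

/-- The layers of the generators depend on the tick only through the objects `typeAt` and the
activity of a color, both stationary; composition, tensor and trace preserve stationarity. -/
theorem isStationary_unfold {a b : StreamType} (D : Diagram G a b) :
    (unfold D).IsStationary := by
  have hs := stationary_typeAt G
  induction D with
  | id a =>
    refine StatefulSeq.isStationary_ofHoms _ (hs _) (hs _) ?_
    filter_upwards [hs a] with k h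
    rw [h]
  | comp f g hf hg => exact hf.comp hg (hs _) (hs _) (hs _)
  | tensor f g hf hg =>
    exact (hf.tensor hg (hs _) (hs _) (hs _) (hs _)).cast
      ((hs _).map₂ (hs _) fun X Y => X ⊗ Y) ((hs _).map₂ (hs _) fun X Y => X ⊗ Y) _ _
  | swap a b =>
    refine StatefulSeq.IsStationary.cast (StatefulSeq.isStationary_ofHoms _
      ((hs _).map₂ (hs _) fun X Y => X ⊗ Y) ((hs _).map₂ (hs _) fun X Y => X ⊗ Y) ?_)
      ((hs _).map₂ (hs _) fun X Y => X ⊗ Y) ((hs _).map₂ (hs _) fun X Y => X ⊗ Y) _ _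
    filter_upwards [hs a, hs b] with k h₁ h₂
    rw [h₁, h₂]
  | @gen c n m g =>
    refine StatefulSeq.isStationary_ofHoms _ (hs _) (hs _) ?_
    filter_upwards [c.stationary_active, hs (copies n c)] with k h h'
    -- Both ticks fall in the same branch of the definition: the layer is `g` at both, or an
    -- `eqToHom` at both.
    by_cases hk : c.active k = true
    · have hk' : c.active (k + 1) = true := h.trans hk
      simp [dif_pos hk, dif_pos hk']
    · have hk' : ¬ c.active (k + 1) = true := fun e => hk (h.symm.trans e)
      rw [dif_neg hk, dif_neg hk']
      exact eqToHom_heq_eqToHom _ _ h'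
  | deriv j =>
    refine StatefulSeq.isStationary_ofHoms _ (hs _) (hs _) ?_
    filter_upwards [hs [Color.delayed j .omega]] with k h
    exact eqToHom_heq_eqToHom _ _ h
  | init j =>
    refine StatefulSeq.isStationary_ofHoms _ (hs _) (hs _) ?_
    filter_upwards [hs [Color.delayed j .one, Color.delayed (j + 1) .omega]] with k h
    exact eqToHom_heq_eqToHom _ _ h
  | dtrace c f hf => exact (hf.cast (hs _) (hs _) _ _).dtrace (hs _) (hs _) (hs _)

end Unfold

/-! ### Finite approximations are monotone and regular -/

section Approximation

variable {C : Type u'} [Category.{v'} C] [MonoidalCategory C]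

theorem eq_of_succ_eq {α : Type*} {a : ℕ → α} {n : ℕ} (h : ∀ k ≥ n, a (k + 1) = a k) (j : ℕ) :
    a (n + j) = a n := by
  induction j with
  | zero => rfl
  | succ j ih => exact (h _ (Nat.le_add_right n j)).trans ih

/-- The repeated factor is written `A (n + 1)` rather than the equal object `A n`, because it is
literally the input or output of layer `n + 1`, from which the regular part is built. -/
theorem prod_eq_pad {A : ℕ → C} {n : ℕ} (h : ∀ k ≥ n, A (k + 1) = A k) (j : ℕ) :
    prod A (n + j) = pad (prod A n) (A (n + 1)) j := by
  induction j with
  | zero => rfl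
  | succ j ih =>
    change prod A (n + j) ⊗ A (n + j + 1) = pad (prod A n) (A (n + 1)) j ⊗ A (n + 1)
    rw [ih, h _ (Nat.le_add_right n j), eq_of_succ_eq h j, h n le_rfl]

/-- Products of a stationary sequence, with its terms as factors. -/
def faObjectProd {A : ℕ → C} (h : Stationary A) : FAObject (prod A) where
  next k := A (k + 1)
  monotone _ := rfl
  regular := by
    obtain ⟨n, hn⟩ := eventually_atTop.1 h
    exact ⟨n, A (n + 1), prod_eq_pad hn⟩

theorem openApprox_step_heq {A A₂ B B₂ X X₂ Y Y₂ M M₂ N N₂ : C}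
    {p : A ⟶ B ⊗ M} {p₂ : A₂ ⟶ B₂ ⊗ M₂} {r : M ⊗ X ⟶ Y ⊗ N} {r₂ : M₂ ⊗ X₂ ⟶ Y₂ ⊗ N₂}
    (eA : A₂ = A) (eB : B₂ = B) (eX : X₂ = X) (eY : Y₂ = Y) (eM : M₂ = M) (eN : N₂ = N)
    (hp : p₂ ≍ p) (hr : r₂ ≍ r) :
    p₂ ▷ X₂ ≫ (α_ _ _ _).hom ≫ B₂ ◁ r₂ ≫ (α_ _ _ _).inv ≍
      p ▷ X ≫ (α_ _ _ _).hom ≫ B ◁ r ≫ (α_ _ _ _).inv := by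
  subst eA eB eX eY eM eN
  subst hp hr
  rfl

variable [SymmetricCategory C]

/-- The regular part needs the same memory object on both sides; the final `eqToHom` closes this
loop and is invisible to `HEq`. -/
theorem braiding_layer_heq {X X₂ Y Y₂ M M₂ N N₂ : C} {l : X ⊗ M ⟶ Y ⊗ N}
    {l₂ : X₂ ⊗ M₂ ⟶ Y₂ ⊗ N₂} (eX : X₂ = X) (eY : Y₂ = Y) (eM : M₂ = M) (eN : N₂ = N)
    (e : N = M) (hl : l₂ ≍ l) :
    (β_ M₂ X₂).hom ≫ l₂ ≍ (β_ M X).hom ≫ l ≫ Y ◁ eqToHom e := by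
  subst eX eY eM eN e
  subst hl
  simp

variable [DiscardCategory C]

/-! ### Monotonicity -/

theorem ground_tensor (A B : C) : ground (A ⊗ B) = A ◁ ground B ≫ (ρ_ A).hom ≫ ground A := by
  rw [ground, DiscardCategory.discard_tensor, tensorHom_def']
  simp [unitors_equal]

/-- Plugging one more layer along the memory and discarding all of its outputs refines discarding
the memory and the inputs of that layer. -/
theorem refines_step {A B X Y M N : C} (p : A ⟶ B ⊗ M) (l : X ⊗ M ⟶ Y ⊗ N) :
    Refines
      (((p ▷ X ≫ (α_ _ _ _).hom ≫ B ◁ ((β_ M X).hom ≫ l) ≫ (α_ _ _ _).inv) ≫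
        (B ⊗ Y) ◁ ground N ≫ (ρ_ _).hom) ≫ B ◁ ground Y ≫ (ρ_ B).hom)
      (A ◁ ground X ≫ (ρ_ A).hom ≫ p ≫ B ◁ ground M ≫ (ρ_ B).hom) := by
  -- The hidden wires are the old memory and the new input. The effect runs the layer and discards
  -- all its outputs; discarding the hidden wires instead gives the right-hand side.
  refine ⟨M ⊗ X, p ▷ X ≫ (α_ _ _ _).hom, (β_ _ _).hom ≫ l ≫ ground (Y ⊗ N), ?_, ?_⟩
  · simp [ground_tensor]
  -- By interchange, discarding the new input before `p` amounts to discarding it after.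
  · have h : A ◁ ground X ≫ (ρ_ A).hom ≫ p = p ▷ X ≫ (B ⊗ M) ◁ ground X ≫ (ρ_ _).hom := by
      rw [← rightUnitor_naturality, whisker_exchange_assoc]
    simp [ground_tensor, reassoc_of% h]

theorem StatefulSeq.isMonotone_approx {A B : ℕ → C} (f : StatefulSeq A B) (hA : Stationary A)
    (hB : Stationary B) : IsMonotone (faObjectProd hA) (faObjectProd hB) f.approx := by
  intro k
  have h := refines_step (f.openApprox k) (f.layer (k + 1))
  -- With the factors `A (k + 1)` the transports in `IsMonotone` are identities by definition;
  -- inserting identities gives `h` the required shape.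
  have e {X Y Z : C} (p : X ⟶ Y) (q : Y ⟶ Z) : 𝟙 X ≫ p ≫ 𝟙 Y ≫ q = p ≫ q := by simp
  rw [← e] at h
  exact h

/-! ### Regularity -/

/-- Turns the heterogeneous equality of open composites back into an equality with explicit
transports, as `IsRegular` demands. -/
theorem approx_eq_of_heq {A A₂ B B₂ M M₂ : C} {p : A ⟶ B ⊗ M} {p₂ : A₂ ⟶ B₂ ⊗ M₂}
    (eA : A₂ = A) (eB : B₂ = B) (eM : M₂ = M) (hp : p₂ ≍ p) :
    p₂ ≫ B₂ ◁ ground M₂ ≫ (ρ_ _).hom =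
      eqToHom eA ≫ p ≫ B ◁ ground M ≫ (ρ_ _).hom ≫ eqToHom eB.symm := by
  subst eA eB eM
  subst hp
  simp

theorem StatefulSeq.isRegular_approx {A B : ℕ → C} (f : StatefulSeq A B) (hA : Stationary A)
    (hB : Stationary B) (hf : f.IsStationary) : IsRegular f.approx := by
  -- One rank serves for inputs, outputs, memories and layers, so the padding of objects and of
  -- morphisms starts at the same place.
  obtain ⟨n, hn⟩ := eventually_atTop.1
    (hA.and (hB.and (hf.1.and hf.2)))
  have eA : ∀ k ≥ n, A (k + 1) = A k := fun k hk => (hn k hk).1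
  have eB : ∀ k ≥ n, B (k + 1) = B k := fun k hk => (hn k hk).2.1
  have eM : ∀ k ≥ n, f.mem (k + 1) = f.mem k := fun k hk => (hn k hk).2.2.1
  have eA' (j : ℕ) : A (n + j + 1) = A (n + 1) := by
    rw [eA _ (Nat.le_add_right n j), eq_of_succ_eq eA, eA n le_rfl]
  have eB' (j : ℕ) : B (n + j + 1) = B (n + 1) := by
    rw [eB _ (Nat.le_add_right n j), eq_of_succ_eq eB, eB n le_rfl]
  have eM' (j : ℕ) : f.mem (n + j) = f.mem n := eq_of_succ_eq eM j
  have hl (j : ℕ) : f.layer (n + j + 1) ≍ f.layer (n + 1) := by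
    induction j with
    | zero => rfl
    | succ j ih => exact (hn _ (Nat.le_add_right n j)).2.2.2.trans ih
  -- The braiding is there because layers take the memory on the right, while the regular part takes
  -- it on the left.
  let gr : f.mem n ⊗ A (n + 1) ⟶ B (n + 1) ⊗ f.mem n :=
    (β_ _ _).hom ≫ f.layer (n + 1) ≫ B (n + 1) ◁ eqToHom (eM n le_rfl)
  have key (j : ℕ) : f.openApprox (n + j) ≍ regularOpen (f.openApprox n) gr j := by
    induction j with
    | zero => rfl
    | succ j ih =>
      exact openApprox_step_heq (prod_eq_pad eA j) (prod_eq_pad eB j) (eA' j) (eB' j) (eM' j)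
        (eM' (j + 1)) ih (braiding_layer_heq (eA' j) (eB' j) (eM' j)
          ((eM' (j + 1)).trans (eM n le_rfl).symm) (eM n le_rfl) (hl j))
  refine ⟨n, A (n + 1), B (n + 1), f.mem n, prod_eq_pad eA, prod_eq_pad eB, f.openApprox n, gr,
    fun j => ?_⟩
  exact approx_eq_of_heq (prod_eq_pad eA j) (prod_eq_pad eB j) (eM' j) (key j)

end Approximation

end StreamLang

open CategoryTheory StreamLang
theorem mainTheorem7
    {G : Type*} [Category* G] [MonoidalCategory G] [SymmetricCategory G]
    [PropCategory G] [DiscardCategory G]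
    {C : Type*} [Category* C] [MonoidalCategory C] [SymmetricCategory C] [DiscardCategory C]
    (F : G ⥤ C) [F.Braided] (hF : DiscardPreserving F) :
    ∃ S : ∀ a : StreamType, FAObject (semType F a),
      ∀ (a b : StreamType) (f : StreamHom G a b) (D : Diagram G a b), D.toHom = f →
        IsFiniteApprox (S a) (S b) (sem F D) := by
  have hs (a : StreamType) : Stationary fun k => F.obj (typeAt G a k) :=
    (stationary_typeAt G a).map F.obj
  -- The factors depend on the type alone, so they are fixed before any diagram is given.
  refine ⟨fun a => faObjectProd (hs a), fun a b _ D _ => ⟨?_, ?_⟩⟩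
  · exact StatefulSeq.isMonotone_approx _ (hs a) (hs b)
  · exact StatefulSeq.isRegular_approx _ (hs a) (hs b)
      ((isStationary_unfold D).map (stationary_typeAt G a) (stationary_typeAt G b) F)
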